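/- Let $\varepsilon>0$. Let $\mathcal P=\{(T_n,Z_n)\}_{n\ge1}$ be a Poisson point process on $[0,\infty)\times\mathbb R$ with intensity $dt\otimes dz/z^2$, defined on a probability space, and let $N=\sum_{n\ge 1}\delta_{(T_n,Z_n)}$ be the Poisson measure that it generates. For $\alpha\in(\varepsilon,1-\varepsilon)$ and $t\in[0,1]$ let $$\mathcal L^\alpha_t=\int_{(0,t]}\int_{(0,1]}z^{1/\alpha}\,N(ds,dz)$$ be the $\alpha$-stable subordinator whose jumps larger than $1$ are truncated, and for every non-decreasing càdlàg function $f:[0,1]\to[\varepsilon,1-\varepsilon]$ let $$\mathcal L^f_t=\int_{(0,t]}\int_{(0,1]}z^{1/f(s-)}\,N(ds,dz),\qquad t\in[0,1],$$ where $f(s-)$ is the left limit of $f$ at $s$. Let $\dim_{\mathcal H}$ denote the Hausdorff dimension in $\mathbb R$, with the convention $\dim_{\mathcal H}\emptyset=-\infty$. Almost surely, all these integrals are finite (simultaneously for all $\alpha\in(\varepsilon,1-\varepsilon)$, all such $f$ and all $t\in[0,1]$) and, for every set $E\subset[0,1]$, every non-decreasing càdlàg function $f:[0,1]\to[\varepsilon,1-\varepsilon]$,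 and all $\alpha,\beta\in(\varepsilon,1-\varepsilon)$ with $\alpha<\inf\{f(t):t\in E\}$ and $\beta>\sup\{f(t):t\in E\}$ (where $\inf\emptyset=+\infty$ and $\sup\emptyset=-\infty$), $$\dim_{\mathcal H}\mathcal L^\alpha(E)\le\dim_{\mathcal H}\mathcal L^f(E)\le\dim_{\mathcal H}\mathcal L^\beta(E)=\frac{\beta}{\alpha}\,\dim_{\mathcal H}\mathcal L^\alpha(E).$$ Here the exceptional null event does not depend on $E$, $f$, $\alpha$, $\beta$. -/

import Mathlib

open MeasureTheory ProbabilityTheory Set Filter Topology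
open scoped NNReal ENNReal

/-- The Hausdorff dimension of a subset of the real line, with the convention that the empty set
has dimension `-∞`. -/
noncomputable def hausdorffDim (S : Set ℝ) : EReal :=
  open Classical in if S = ∅ then ⊥ else ((dimH S : ℝ≥0∞) : EReal)

/-- The counting measure `∑ₙ δ_{Xₙ(ω)}` of a sequence of random points. -/
noncomputable def pointMeasure {Ω S : Type*} [MeasurableSpace S] (X : ℕ → Ω → S) (ω : Ω) :
    Measure S :=
  Measure.sum fun n => Measure.dirac (X n ω)

/-- The random points `X₀, X₁, …` form a Poisson point process with intensity `Λ`: the number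
of points in a measurable set of finite intensity `Λ A` is Poisson distributed with
parameter `Λ A`, and the numbers of points in finitely many pairwise disjoint measurable sets are
independent. -/
structure IsPoissonPointProcess {Ω S : Type*} [MeasurableSpace Ω] [MeasurableSpace S]
    (X : ℕ → Ω → S) (Λ : Measure S) (P : Measure Ω) : Prop where
  measurable_point : ∀ n, Measurable (X n)
  law_count : ∀ A : Set S, MeasurableSet A → Λ A ≠ ∞ →
    P.map (fun ω => pointMeasure X ω A) =
      (poissonMeasure (Λ A).toNNReal).map (fun k : ℕ => (k : ℝ≥0∞))
  indep_count : ∀ (m : ℕ) (A : Fin m → Set S), (∀ i, MeasurableSet (A i)) →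
    Pairwise (fun i j => Disjoint (A i) (A j)) →
      iIndepFun (fun i ω => pointMeasure X ω (A i)) P

/-- The measure `dt ⊗ dz / z²` on `[0, ∞) × ℝ`, as a measure on `ℝ × ℝ`. -/
noncomputable def stableIntensity : Measure (ℝ × ℝ) :=
  ((volume : Measure ℝ).restrict (Ici 0)).prod
    ((volume : Measure ℝ).withDensity fun z => ENNReal.ofReal (1 / z ^ 2))

/-- The truncated `α`-stable process driven by `N`, at time `t`:
`∫_{(0,t]} ∫_{(0,1]} z ^ (1/α) N(ds, dz)`. -/
noncomputable def stableProcess (N : Measure (ℝ × ℝ)) (α t : ℝ) : ℝ :=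
  ∫ x in Ioc 0 t ×ˢ Ioc 0 1, x.2 ^ (1 / α) ∂N

/-- The process with index function `f` driven by `N`, at time `t`:
`∫_{(0,t]} ∫_{(0,1]} z ^ (1/f(s-)) N(ds, dz)`, where `f(s-)` is the left limit of `f` at `s`. -/
noncomputable def indexedProcess (N : Measure (ℝ × ℝ)) (f : ℝ → ℝ) (t : ℝ) : ℝ :=
  ∫ x in Ioc 0 t ×ˢ Ioc 0 1, x.2 ^ (1 / Function.leftLim f x.1) ∂N

/-- `f` is càdlàg on `[0,1]`; the values of `f` outside `[0,1]` are irrelevant. -/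
def CadlagOnUnit (f : ℝ → ℝ) : Prop :=
  (∀ t ∈ Ico (0 : ℝ) 1, ContinuousWithinAt f (Ioi t) t) ∧
    ∀ t ∈ Ioc (0 : ℝ) 1, ∃ l : ℝ, Tendsto f (𝓝[<] t) (𝓝 l)

/-- `f` restricts to a non-decreasing càdlàg function from `[0,1]` to `[ε, 1 - ε]`. -/
structure IsIndexFunction (ε : ℝ) (f : ℝ → ℝ) : Prop where
  mapsTo : MapsTo f (Icc 0 1) (Icc ε (1 - ε))
  monotoneOn : MonotoneOn f (Icc 0 1)
  cadlag : CadlagOnUnit f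

/-!
Almost surely, one regularity property of the point configuration `N` (`IsDyadicallyRegular`) holds,
and everything else is deterministic. It says that over a dyadic time interval of length `2⁻ᵏ` there
are at most `C + k` points of size between `2⁻ᵏ⁻¹` and `2⁻ᵏ`, and, for `k` large, at least one point
of size larger than `2⁻ᵏ / (k + 1)`. The first count is Poisson of parameter `1`, the second one has
parameter at least `k`, so the union bound over the `2 ^ (k + 1)` intervals of level `k` and the
Borel-Cantelli lemma apply (`ae_isDyadicallyRegular`).

The comparison of the three dimensions is a comparison of increments between points `s < t` of `E`,
through `dimH_image_le_of_increments`: if `|h t - h s| ≤ C |g t - g s| ^ η` on `E`, then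
`dimH (h '' E) ≤ dimH (g '' E) / η`.

* Between two points of `E` the index `f(u-)` lies in `[α, β]`. As all sizes are at most `1`, the
  increments of `L^α`, `L^f`, `L^β` are ordered, which gives the two inequalities.
* As `∑ aᵢ ^ p ≤ (∑ aᵢ) ^ p` with `p = β / α`, the increments of `L^α` are at most the power `β / α`
  of those of `L^β` (`setIntegral_rpow_le_rpow_setIntegral`), so that
  `(β / α) dim L^α(E) ≤ dim L^β(E)`.
* Conversely, let `r` be the increment of `L^α` over `(s, t]`. Every point in this time interval has
  size at most `ρ = r ^ α`. Regularity bounds the length of an interval without points larger than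
  `ρ` by about `ρ`, and the increment of `L^β` contributed by the points smaller than `ρ` in such an
  interval by about `ρ ^ (1 / β) = r ^ (α / β)`, up to an arbitrarily small loss in the exponents
  (`IsDyadicallyRegular.exists_setIntegral_le_rpow_setIntegral`). Hence
  `dim L^β(E) ≤ (β / α) dim L^α(E)`.
-/

/-! ### Sums of Dirac masses -/

section PointMeasure

variable {Ω S : Type*} [MeasurableSpace S] {X : ℕ → Ω → S} {ω : Ω}

lemma exists_mem_of_pointMeasure_ne_zero {A : Set S} (hA : MeasurableSet A)
    (h : pointMeasure X ω A ≠ 0) : ∃ n, X n ω ∈ A := by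
  contrapose! h
  simp [pointMeasure, Measure.sum_apply _ hA, Measure.dirac_apply' _ hA, h]

lemma measurable_pointMeasure_apply [MeasurableSpace Ω] (hX : ∀ n, Measurable (X n)) {A : Set S}
    (hA : MeasurableSet A) : Measurable fun ω => pointMeasure X ω A := by
  simp only [pointMeasure, Measure.sum_apply _ hA, Measure.dirac_apply' _ hA]
  exact Measurable.tsum fun n => (measurable_one.indicator hA).comp (hX n)

/-- A point of the process lying in `A` contributes its own value to the integral over `A`. -/
lemma le_setIntegral_pointMeasure {A : Set S} (hA : MeasurableSet A) {φ : S → ℝ}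
    (hφ : IntegrableOn φ A (pointMeasure X ω)) (h0 : ∀ x ∈ A, 0 ≤ φ x) {n : ℕ} (hn : X n ω ∈ A)
    [MeasurableSingletonClass S] :
    φ (X n ω) ≤ ∫ x in A, φ x ∂(pointMeasure X ω) := by
  have hnn : 0 ≤ᵐ[(pointMeasure X ω).restrict A] φ := ae_restrict_of_forall_mem hA h0
  rw [← ENNReal.ofReal_le_ofReal_iff (integral_nonneg_of_ae hnn),
    ofReal_integral_eq_lintegral_ofReal hφ hnn]
  have hle : (Measure.dirac (X n ω)).restrict A ≤ (pointMeasure X ω).restrict A :=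
    Measure.restrict_mono le_rfl (Measure.le_sum (fun n => Measure.dirac (X n ω)) n)
  refine le_trans ?_ (lintegral_mono' hle le_rfl)
  classical
  rw [restrict_dirac' hA, if_pos hn, lintegral_dirac]

variable [MeasurableSingletonClass S]

lemma ae_pointMeasure_of_forall {p : S → Prop} (h : ∀ n, p (X n ω)) :
    ∀ᵐ x ∂(pointMeasure X ω), p x := by
  rw [pointMeasure, Measure.ae_sum_iff]
  intro n
  rw [ae_dirac_eq]
  exact h n

/-- A sum of Dirac masses does not see non-measurability: it is carried by a countable set. -/
lemma aestronglyMeasurable_pointMeasure (φ : S → ℝ) (A : Set S) :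
    AEStronglyMeasurable φ ((pointMeasure X ω).restrict A) := by
  have h : AEMeasurable φ (pointMeasure X ω) :=
    aemeasurable_sum_measure_iff.2 fun _ => aemeasurable_dirac
  exact h.restrict.aestronglyMeasurable

end PointMeasure

/-! ### Dyadic intervals and regular point configurations -/

/-- The `j`-th half-open dyadic interval of length `2⁻ᵏ` to the right of the origin. -/
def dyadicIoc (k j : ℕ) : Set ℝ := Ioc ((j : ℝ) / 2 ^ k) (((j : ℝ) + 1) / 2 ^ k)

lemma mem_dyadicIoc {k j : ℕ} {t : ℝ} :
    t ∈ dyadicIoc k j ↔ (j : ℝ) < t * 2 ^ k ∧ t * 2 ^ k ≤ (j : ℝ) + 1 := by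
  rw [dyadicIoc, mem_Ioc, div_lt_iff₀ (by positivity), le_div_iff₀ (by positivity)]

lemma measurableSet_dyadicIoc (k j : ℕ) : MeasurableSet (dyadicIoc k j) := measurableSet_Ioc

lemma dyadicIoc_zero_zero : dyadicIoc 0 0 = Ioc 0 1 := by simp [dyadicIoc]

lemma dyadicIoc_add_subset (k l j : ℕ) : dyadicIoc (k + l) (j * 2 ^ l) ⊆ dyadicIoc k j := by
  intro t ht
  rw [mem_dyadicIoc] at ht ⊢
  have h2 : (1 : ℝ) ≤ 2 ^ l := one_le_pow₀ (by norm_num)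
  have hpos : (0 : ℝ) < 2 ^ l := by positivity
  push_cast [pow_add, ← mul_assoc] at ht
  refine ⟨lt_of_mul_lt_mul_right ht.1 hpos.le, le_of_mul_le_mul_right ?_ hpos⟩
  nlinarith [ht.2]

lemma dyadicIoc_subset_biUnion (k l j : ℕ) :
    dyadicIoc k j ⊆ ⋃ i ∈ Finset.range (2 ^ l), dyadicIoc (k + l) (j * 2 ^ l + i) := by
  intro t ht
  rw [mem_dyadicIoc] at ht
  have hpos : (0 : ℝ) < 2 ^ l := by positivity
  have h1 : ((j * 2 ^ l : ℕ) : ℝ) < t * 2 ^ (k + l) := by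
    push_cast [pow_add, ← mul_assoc]
    exact mul_lt_mul_of_pos_right ht.1 hpos
  have h2 : t * 2 ^ (k + l) ≤ (((j + 1) * 2 ^ l : ℕ) : ℝ) := by
    push_cast [pow_add, ← mul_assoc]
    exact mul_le_mul_of_nonneg_right ht.2 hpos.le
  have h3 := Nat.lt_ceil.2 h1
  have h4 := Nat.ceil_le.2 h2
  obtain ⟨i, hi⟩ := Nat.exists_eq_add_of_lt h3
  simp only [mem_iUnion, Finset.mem_range]
  refine ⟨i, by rw [add_mul] at h4; omega, mem_dyadicIoc.2 ⟨?_, ?_⟩⟩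
  · exact Nat.lt_ceil.1 (by omega)
  · have := Nat.le_ceil (t * 2 ^ (k + l))
    rw [hi] at this
    exact_mod_cast this

/-- The deterministic regularity of a point configuration in the time-size half-plane on which the
comparison of the processes rests. Over a dyadic time interval of length `2⁻ᵏ`, the number of points
of size comparable to `2⁻ᵏ` grows at most linearly in `k`, and, for large `k`, there is a point of
size larger than `2⁻ᵏ / (k + 1)`. The intervals considered cover `(0, 2]`, so that every interval
meeting `(0, 1]` has a right neighbour among them. -/
structure IsDyadicallyRegular (N : Measure (ℝ × ℝ)) : Prop where
  exists_count_le : ∃ C : ℕ, ∀ k j, j < 2 ^ (k + 1) →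
    N (dyadicIoc k j ×ˢ Ioc (1 / 2 ^ (k + 1)) (1 / 2 ^ k)) ≤ ((C + k : ℕ) : ℝ≥0∞)
  eventually_hit : ∀ᶠ k : ℕ in atTop, ∀ j < 2 ^ (k + 1),
    N (dyadicIoc k j ×ˢ Ioc (1 / (2 ^ k * ((k : ℝ) + 1))) 1) ≠ 0

/-! ### Poisson estimates -/

lemma stableIntensity_prod_Ioc {a b c d : ℝ} (ha : 0 ≤ a) (hc : 0 < c) (hcd : c ≤ d) :
    stableIntensity (Ioc a b ×ˢ Ioc c d) =
      ENNReal.ofReal (b - a) * ENNReal.ofReal (1 / c - 1 / d) := by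
  have hsub : Ioc a b ∩ Ici 0 = Ioc a b :=
    inter_eq_left.2 fun x hx => ha.trans hx.1.le
  have hint : IntegrableOn (fun z : ℝ => 1 / z ^ 2) (Ioc c d) := by
    refine (ContinuousOn.integrableOn_Icc ?_).mono_set Ioc_subset_Icc_self
    refine continuousOn_const.div (by fun_prop) fun z hz => ?_
    have : 0 < z := hc.trans_le hz.1
    positivity
  have hval : ∫ z in Ioc c d, 1 / z ^ 2 = 1 / c - 1 / d := by
    rw [← intervalIntegral.integral_of_le hcd]
    have hderiv : ∀ z ∈ uIcc c d, HasDerivAt (fun z : ℝ => -(1 / z)) (1 / z ^ 2) z := by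
      intro z hz
      rw [uIcc_of_le hcd] at hz
      have hz0 : z ≠ 0 := (hc.trans_le hz.1).ne'
      simpa [one_div] using (hasDerivAt_inv hz0).fun_neg
    rw [intervalIntegral.integral_eq_sub_of_hasDerivAt hderiv
      ((intervalIntegrable_iff_integrableOn_Ioc_of_le hcd).2 hint)]
    ring
  rw [stableIntensity, Measure.prod_prod, Measure.restrict_apply measurableSet_Ioc, hsub,
    Real.volume_Ioc, withDensity_apply _ measurableSet_Ioc,
    ← ofReal_integral_eq_lintegral_ofReal hint (Eventually.of_forall fun z => by positivity), hval]

lemma poissonMeasure_zero_singleton_le {r : ℝ≥0} {s : ℝ} (h : s ≤ r) :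
    poissonMeasure r {0} ≤ ENNReal.ofReal (Real.exp (-s)) := by
  rw [poissonMeasure_singleton]
  refine ENNReal.ofReal_le_ofReal ?_
  simpa using h

/-- The exponential Markov inequality for a Poisson variable of parameter `1`. -/
lemma poissonMeasure_one_Ioi_le (k : ℕ) :
    poissonMeasure 1 (Ioi k) ≤ ENNReal.ofReal (Real.exp 3 * (1 / 4) ^ k) := by
  have hsum : HasSum (fun n : ℕ => Real.exp (-1) * (1 / 4) ^ k * ((4 : ℝ) ^ n / n.factorial))
      (Real.exp 3 * (1 / 4) ^ k) := by
    have h := (NormedSpace.expSeries_div_hasSum_exp (4 : ℝ)).mul_left (Real.exp (-1) * (1 / 4) ^ k)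
    have he : Real.exp (-1) * (1 / 4) ^ k * Real.exp 4 = Real.exp 3 * (1 / 4) ^ k := by
      rw [mul_right_comm, ← Real.exp_add]
      norm_num
    rwa [← Real.exp_eq_exp_ℝ, he] at h
  rw [poissonMeasure, Measure.sum_apply _ (measurableSet_Ioi), ← hsum.tsum_eq,
    ENNReal.ofReal_tsum_of_nonneg (fun n => by positivity) hsum.summable]
  refine ENNReal.tsum_le_tsum fun n => ?_
  rw [Measure.smul_apply, smul_eq_mul, Measure.dirac_apply' _ measurableSet_Ioi]
  by_cases hn : k < n
  · simp only [indicator, mem_Ioi, hn, if_true, Pi.one_apply, mul_one]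
    refine ENNReal.ofReal_le_ofReal ?_
    have h1 : (1 : ℝ) ≤ (1 / 4) ^ k * 4 ^ n := by
      rw [one_div, inv_pow, inv_mul_eq_div, one_le_div (by positivity)]
      exact pow_le_pow_right₀ (by norm_num) hn.le
    calc Real.exp (-((1 : ℝ≥0) : ℝ)) * ((1 : ℝ≥0) : ℝ) ^ n / n.factorial
        = Real.exp (-1) / n.factorial * 1 := by simp
      _ ≤ Real.exp (-1) / n.factorial * ((1 / 4) ^ k * 4 ^ n) := by gcongr
      _ = _ := by ring
  · simp [hn]

section Probability

variable {Ω : Type*} [MeasurableSpace Ω] {P : Measure Ω}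

lemma IsPoissonPointProcess.prob_count {S : Type*} [MeasurableSpace S] {X : ℕ → Ω → S}
    {Λ : Measure S} (h : IsPoissonPointProcess X Λ P) {A : Set S} (hA : MeasurableSet A)
    (hΛ : Λ A ≠ ∞) {B : Set ℝ≥0∞} (hB : MeasurableSet B) :
    P {ω | pointMeasure X ω A ∈ B} =
      poissonMeasure (Λ A).toNNReal {k : ℕ | (k : ℝ≥0∞) ∈ B} := by
  have h1 := DFunLike.congr_fun (h.law_count A hA hΛ) B
  rwa [Measure.map_apply (measurable_pointMeasure_apply h.measurable_point hA) hB,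
    Measure.map_apply (measurable_of_countable _) hB] at h1

variable {X : ℕ → Ω → ℝ × ℝ}

lemma measurableSet_dyadicIoc_prod (k j : ℕ) (a b : ℝ) :
    MeasurableSet (dyadicIoc k j ×ˢ Ioc a b) :=
  (measurableSet_dyadicIoc k j).prod measurableSet_Ioc

lemma stableIntensity_dyadicIoc_prod_Ioc (k j : ℕ) {c d : ℝ} (hc : 0 < c) (hcd : c ≤ d) :
    stableIntensity (dyadicIoc k j ×ˢ Ioc c d) = ENNReal.ofReal (1 / 2 ^ k * (1 / c - 1 / d)) := by
  rw [dyadicIoc, stableIntensity_prod_Ioc (by positivity) hc hcd,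
    ← ENNReal.ofReal_mul (sub_nonneg.2 (by gcongr; linarith))]
  congr 2
  ring

lemma stableIntensity_dyadicIoc_prod_band (k j : ℕ) :
    stableIntensity (dyadicIoc k j ×ˢ Ioc (1 / 2 ^ (k + 1)) (1 / 2 ^ k)) = 1 := by
  rw [stableIntensity_dyadicIoc_prod_Ioc _ _ (by positivity)
    (one_div_le_one_div_of_le (by positivity) (pow_le_pow_right₀ (by norm_num) (Nat.le_succ k))),
    one_div_one_div, one_div_one_div, ENNReal.ofReal_eq_one, pow_succ]
  field_simp
  ring

lemma ae_count_ne_top (h : IsPoissonPointProcess X stableIntensity P) :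
    ∀ᵐ ω ∂P, ∀ k j : ℕ,
      pointMeasure X ω (dyadicIoc k j ×ˢ Ioc (1 / 2 ^ (k + 1)) (1 / 2 ^ k)) ≠ ∞ := by
  rw [ae_all_iff]; intro k
  rw [ae_all_iff]; intro j
  rw [ae_iff]
  have := h.prob_count (measurableSet_dyadicIoc_prod k j (1 / 2 ^ (k + 1)) (1 / 2 ^ k))
    (by rw [stableIntensity_dyadicIoc_prod_band]; exact ENNReal.one_ne_top)
    (measurableSet_singleton ∞)
  simpa using this

lemma ae_eventually_count_le (h : IsPoissonPointProcess X stableIntensity P) :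
    ∀ᵐ ω ∂P, ∀ᶠ k : ℕ in atTop, ∀ j < 2 ^ (k + 1),
      pointMeasure X ω (dyadicIoc k j ×ˢ Ioc (1 / 2 ^ (k + 1)) (1 / 2 ^ k)) ≤ k := by
  let A : ℕ → ℕ → Set (ℝ × ℝ) := fun k j => dyadicIoc k j ×ˢ Ioc (1 / 2 ^ (k + 1)) (1 / 2 ^ k)
  let s : ℕ → Set Ω := fun k =>
    ⋃ j ∈ Finset.range (2 ^ (k + 1)), {ω | pointMeasure X ω (A k j) ∈ Ioi (k : ℝ≥0∞)}
  have hs : ∀ k, P (s k) ≤ ENNReal.ofReal (2 * Real.exp 3 * (1 / 2) ^ k) := by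
    intro k
    calc P (s k)
        ≤ ∑ j ∈ Finset.range (2 ^ (k + 1)), P {ω | pointMeasure X ω (A k j) ∈ Ioi (k : ℝ≥0∞)} :=
          measure_biUnion_finset_le _ _
      _ ≤ ∑ j ∈ Finset.range (2 ^ (k + 1)), ENNReal.ofReal (Real.exp 3 * (1 / 4) ^ k) := by
          refine Finset.sum_le_sum fun j _ => ?_
          rw [h.prob_count (measurableSet_dyadicIoc_prod _ _ _ _)
            (by rw [stableIntensity_dyadicIoc_prod_band]; exact ENNReal.one_ne_top) measurableSet_Ioi,
            stableIntensity_dyadicIoc_prod_band]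
          simpa [Ioi] using poissonMeasure_one_Ioi_le k
      _ = ENNReal.ofReal (2 * Real.exp 3 * (1 / 2) ^ k) := by
          rw [Finset.sum_const, Finset.card_range, nsmul_eq_mul, ← ENNReal.ofReal_natCast,
            ← ENNReal.ofReal_mul (by positivity)]
          congr 1
          have : ((1 : ℝ) / 4) ^ k = (1 / 2) ^ k * (1 / 2) ^ k := by
            rw [← mul_pow]; norm_num
          rw [this]
          push_cast
          rw [pow_succ, one_div, inv_pow]
          field_simp
  have hsum : Summable fun k : ℕ => 2 * Real.exp 3 * (1 / 2 : ℝ) ^ k :=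
    summable_geometric_two.mul_left _
  have hfin : ∑' k, P (s k) ≠ ∞ :=
    ne_top_of_le_ne_top hsum.tsum_ofReal_ne_top (ENNReal.tsum_le_tsum hs)
  filter_upwards [ae_eventually_notMem hfin] with ω hω
  filter_upwards [hω] with k hk j hj
  simp only [s, mem_iUnion, Finset.mem_range, not_exists] at hk
  simpa [A] using hk j hj

lemma ae_eventually_hit (h : IsPoissonPointProcess X stableIntensity P) :
    ∀ᵐ ω ∂P, ∀ᶠ k : ℕ in atTop, ∀ j < 2 ^ (k + 1),
      pointMeasure X ω (dyadicIoc k j ×ˢ Ioc (1 / (2 ^ k * ((k : ℝ) + 1))) 1) ≠ 0 := by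
  let A : ℕ → ℕ → Set (ℝ × ℝ) := fun k j => dyadicIoc k j ×ˢ Ioc (1 / (2 ^ k * ((k : ℝ) + 1))) 1
  let s : ℕ → Set Ω := fun k =>
    ⋃ j ∈ Finset.range (2 ^ (k + 1)), {ω | pointMeasure X ω (A k j) ∈ ({0} : Set ℝ≥0∞)}
  have hA : ∀ k j, stableIntensity (A k j) =
      ENNReal.ofReal (1 / 2 ^ k * (2 ^ k * ((k : ℝ) + 1) - 1)) := by
    intro k j
    rw [stableIntensity_dyadicIoc_prod_Ioc _ _ (by positivity), one_div_one_div, one_div_one]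
    rw [div_le_one (by positivity)]
    exact one_le_mul_of_one_le_of_one_le (one_le_pow₀ (by norm_num))
      (by linarith [k.cast_nonneg (α := ℝ)])
  have hs : ∀ k, P (s k) ≤ ENNReal.ofReal (2 * (2 * Real.exp (-1)) ^ k) := by
    intro k
    calc P (s k)
        ≤ ∑ j ∈ Finset.range (2 ^ (k + 1)), P {ω | pointMeasure X ω (A k j) ∈ ({0} : Set ℝ≥0∞)} :=
          measure_biUnion_finset_le _ _
      _ ≤ ∑ j ∈ Finset.range (2 ^ (k + 1)), ENNReal.ofReal (Real.exp (-k)) := by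
          refine Finset.sum_le_sum fun j _ => ?_
          rw [h.prob_count (measurableSet_dyadicIoc_prod _ _ _ _)
            (by rw [hA]; exact ENNReal.ofReal_ne_top) (measurableSet_singleton 0)]
          have : {n : ℕ | (n : ℝ≥0∞) ∈ ({0} : Set ℝ≥0∞)} = {0} := by ext; simp
          rw [this]
          refine poissonMeasure_zero_singleton_le ?_
          rw [hA]
          refine le_trans ?_ (Real.le_coe_toNNReal _)
          have h1 : (1 : ℝ) / 2 ^ k ≤ 1 := by
            rw [div_le_one (by positivity)]; exact one_le_pow₀ (by norm_num)
          have : (1 : ℝ) / 2 ^ k * (2 ^ k * ((k : ℝ) + 1) - 1) = k + 1 - 1 / 2 ^ k := by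
            field_simp
          rw [this]
          linarith
      _ = ENNReal.ofReal (2 * (2 * Real.exp (-1)) ^ k) := by
          rw [Finset.sum_const, Finset.card_range, nsmul_eq_mul, ← ENNReal.ofReal_natCast,
            ← ENNReal.ofReal_mul (by positivity), mul_pow, ← Real.exp_nat_mul]
          congr 1
          push_cast
          rw [pow_succ]
          ring_nf
  have hlt : 2 * Real.exp (-1) < 1 := by
    rw [Real.exp_neg, ← div_eq_mul_inv, div_lt_one (Real.exp_pos _)]
    linarith [Real.exp_one_gt_d9]
  have hsum : Summable fun k : ℕ => 2 * (2 * Real.exp (-1)) ^ k :=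
    (summable_geometric_of_lt_one (by positivity) hlt).mul_left _
  have hfin : ∑' k, P (s k) ≠ ∞ :=
    ne_top_of_le_ne_top hsum.tsum_ofReal_ne_top (ENNReal.tsum_le_tsum hs)
  filter_upwards [ae_eventually_notMem hfin] with ω hω
  filter_upwards [hω] with k hk j hj
  simp only [s, mem_iUnion, Finset.mem_range, not_exists] at hk
  exact hk j hj

/-- Almost surely the points of the process are dyadically regular. The linear bound on the counts
holds at all large levels by Borel-Cantelli; the finitely many remaining counts are finite and are
absorbed by the constant. -/
lemma ae_isDyadicallyRegular (h : IsPoissonPointProcess X stableIntensity P) :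
    ∀ᵐ ω ∂P, IsDyadicallyRegular (pointMeasure X ω) := by
  filter_upwards [ae_count_ne_top h, ae_eventually_count_le h, ae_eventually_hit h]
    with ω h1 h2 h3
  refine ⟨?_, h3⟩
  obtain ⟨K, hK⟩ := eventually_atTop.1 h2
  let B : ℕ → ℕ → ℝ≥0∞ := fun k j =>
    pointMeasure X ω (dyadicIoc k j ×ˢ Ioc (1 / 2 ^ (k + 1)) (1 / 2 ^ k))
  have hfin : ∑ k ∈ Finset.range K, ∑ j ∈ Finset.range (2 ^ (k + 1)), B k j ≠ ∞ :=
    ENNReal.sum_ne_top.2 fun k _ => ENNReal.sum_ne_top.2 fun j _ => h1 k j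
  obtain ⟨C, hC⟩ := ENNReal.exists_nat_gt hfin
  refine ⟨C, fun k j hj => ?_⟩
  by_cases hk : K ≤ k
  · exact (hK k hk j hj).trans (by exact_mod_cast Nat.le_add_left k C)
  · have e1 : B k j ≤ ∑ j ∈ Finset.range (2 ^ (k + 1)), B k j :=
      Finset.single_le_sum (f := B k) (fun _ _ => zero_le) (Finset.mem_range.2 hj)
    have e2 : ∑ j ∈ Finset.range (2 ^ (k + 1)), B k j ≤
        ∑ k ∈ Finset.range K, ∑ j ∈ Finset.range (2 ^ (k + 1)), B k j :=
      Finset.single_le_sum (f := fun k => ∑ j ∈ Finset.range (2 ^ (k + 1)), B k j)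
        (fun _ _ => zero_le) (Finset.mem_range.2 (not_le.1 hk))
    refine (e1.trans (e2.trans hC.le)).trans ?_
    exact_mod_cast Nat.le_add_right C k

end Probability

/-! ### Consequences of regularity -/

lemma half_rpow_lt_one {δ : ℝ} (hδ : 0 < δ) : ((1 : ℝ) / 2) ^ δ < 1 :=
  Real.rpow_lt_one (by norm_num) (by norm_num) hδ

lemma one_div_two_pow_rpow_one_add (k : ℕ) (δ : ℝ) :
    ((1 : ℝ) / 2 ^ k) ^ (1 + δ) = 1 / 2 ^ k * (((1 : ℝ) / 2) ^ δ) ^ k := by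
  rw [Real.rpow_add (by positivity), Real.rpow_one, ← one_div_pow, ← Real.rpow_natCast,
    ← Real.rpow_natCast, ← Real.rpow_mul (by norm_num), ← Real.rpow_mul (by norm_num), mul_comm δ]

lemma summable_add_mul_geometric (C : ℕ) {q : ℝ} (h0 : 0 ≤ q) (h1 : q < 1) :
    Summable fun m : ℕ => q ^ m * ((C + m : ℕ) : ℝ) := by
  have hq : ‖q‖ < 1 := by rwa [Real.norm_of_nonneg h0]
  have h2 := summable_pow_mul_geometric_of_norm_lt_one 1 hq
  have h3 := (summable_geometric_of_lt_one h0 h1).mul_left (C : ℝ)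
  refine (h3.add h2).congr fun m => ?_
  push_cast
  ring

lemma Ioc_zero_subset_iUnion_bands (k : ℕ) :
    Ioc (0 : ℝ) (1 / 2 ^ k) ⊆ ⋃ l : ℕ, Ioc (1 / 2 ^ (k + l + 1)) (1 / 2 ^ (k + l)) := by
  intro z hz
  have hex : ∃ l : ℕ, (1 : ℝ) / 2 ^ (k + l + 1) < z := by
    obtain ⟨l, hl⟩ := exists_pow_lt_of_lt_one hz.1 (by norm_num : (1 / 2 : ℝ) < 1)
    refine ⟨l, lt_of_le_of_lt ?_ hl⟩
    rw [one_div_pow]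
    exact one_div_le_one_div_of_le (by positivity) (pow_le_pow_right₀ (by norm_num) (by omega))
  classical
  refine mem_iUnion.2 ⟨Nat.find hex, Nat.find_spec hex, ?_⟩
  rcases Nat.eq_zero_or_pos (Nat.find hex) with h | h
  · rw [h]; exact hz.2
  · have := Nat.find_min hex (Nat.sub_lt h one_pos)
    rw [not_lt] at this
    convert this using 3
    omega

namespace IsDyadicallyRegular

/-- The points of size at most `2⁻ᵏ` in a dyadic time interval of length `2⁻ᵏ` have a `(1 + δ)`-th
moment of order `2⁻ᵏ`. In the band of sizes around `2⁻ᵐ`, `m ≥ k`, there are at most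
`2 ^ (m - k) * (C + m)` of them, and the series `∑ 2 ^ (-δ m) * (C + m)` converges. -/
lemma exists_lintegral_le {N : Measure (ℝ × ℝ)} (hN : IsDyadicallyRegular N) {δ : ℝ}
    (hδ : 0 < δ) :
    ∃ K : ℝ, 0 ≤ K ∧ ∀ k j, j < 2 ^ (k + 1) →
      ∫⁻ x in dyadicIoc k j ×ˢ Ioc 0 (1 / 2 ^ k), ENNReal.ofReal (x.2 ^ (1 + δ)) ∂N ≤
        ENNReal.ofReal (K * (1 / 2 ^ k)) := by
  obtain ⟨C, hC⟩ := hN.exists_count_le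
  set q : ℝ := (1 / 2 : ℝ) ^ δ with hq
  have hq0 : 0 < q := by positivity
  have hsum := summable_add_mul_geometric C hq0.le (half_rpow_lt_one hδ)
  have hnn : ∀ m : ℕ, 0 ≤ q ^ m * ((C + m : ℕ) : ℝ) := fun m => by positivity
  refine ⟨∑' m : ℕ, q ^ m * ((C + m : ℕ) : ℝ), tsum_nonneg hnn, fun k j hj => ?_⟩
  let A : ℕ → Set (ℝ × ℝ) := fun l =>
    dyadicIoc k j ×ˢ Ioc (1 / 2 ^ (k + l + 1)) (1 / 2 ^ (k + l))
  have hcover : dyadicIoc k j ×ˢ Ioc (0 : ℝ) (1 / 2 ^ k) ⊆ ⋃ l, A l := by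
    rw [← prod_iUnion]
    exact prod_mono le_rfl (Ioc_zero_subset_iUnion_bands k)
  have hcount : ∀ l, N (A l) ≤ ENNReal.ofReal (2 ^ l * ((C + (k + l) : ℕ) : ℝ)) := by
    intro l
    have hsub : A l ⊆ ⋃ i ∈ Finset.range (2 ^ l),
        dyadicIoc (k + l) (j * 2 ^ l + i) ×ˢ Ioc (1 / 2 ^ (k + l + 1)) (1 / 2 ^ (k + l)) := by
      simp only [← iUnion_prod_const]
      exact prod_mono (dyadicIoc_subset_biUnion k l j) le_rfl
    calc N (A l) ≤ ∑ i ∈ Finset.range (2 ^ l), N (dyadicIoc (k + l) (j * 2 ^ l + i) ×ˢ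
            Ioc (1 / 2 ^ (k + l + 1)) (1 / 2 ^ (k + l))) :=
          (measure_mono hsub).trans (measure_biUnion_finset_le _ _)
      _ ≤ ∑ i ∈ Finset.range (2 ^ l), ((C + (k + l) : ℕ) : ℝ≥0∞) := by
          refine Finset.sum_le_sum fun i hi => hC _ _ ?_
          rw [Finset.mem_range] at hi
          calc j * 2 ^ l + i < (j + 1) * 2 ^ l := by rw [add_mul]; omega
            _ ≤ 2 ^ (k + 1) * 2 ^ l := Nat.mul_le_mul_right _ hj
            _ = 2 ^ (k + l + 1) := by ring
      _ = _ := by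
          rw [Finset.sum_const, Finset.card_range, nsmul_eq_mul, ← ENNReal.ofReal_natCast,
            ← ENNReal.ofReal_natCast, ← ENNReal.ofReal_mul (by positivity)]
          push_cast
          rfl
  have hband : ∀ l, ∫⁻ x in A l, ENNReal.ofReal (x.2 ^ (1 + δ)) ∂N ≤
      ENNReal.ofReal (1 / 2 ^ k * (q ^ (k + l) * ((C + (k + l) : ℕ) : ℝ))) := by
    intro l
    calc ∫⁻ x in A l, ENNReal.ofReal (x.2 ^ (1 + δ)) ∂N
        ≤ ∫⁻ _ in A l, ENNReal.ofReal ((1 / 2 ^ (k + l)) ^ (1 + δ)) ∂N := by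
          refine setLIntegral_mono measurable_const fun x hx => ENNReal.ofReal_le_ofReal ?_
          have h0 : 0 < x.2 := lt_trans (by positivity) hx.2.1
          exact Real.rpow_le_rpow h0.le hx.2.2 (by linarith)
      _ = ENNReal.ofReal ((1 / 2 ^ (k + l)) ^ (1 + δ)) * N (A l) := setLIntegral_const _ _
      _ ≤ ENNReal.ofReal ((1 / 2 ^ (k + l)) ^ (1 + δ)) *
            ENNReal.ofReal (2 ^ l * ((C + (k + l) : ℕ) : ℝ)) := by gcongr; exact hcount l
      _ = _ := by
          rw [← ENNReal.ofReal_mul (by positivity), one_div_two_pow_rpow_one_add, ← hq]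
          congr 1
          rw [pow_add 2 k l]
          field_simp
  calc ∫⁻ x in dyadicIoc k j ×ˢ Ioc 0 (1 / 2 ^ k), ENNReal.ofReal (x.2 ^ (1 + δ)) ∂N
      ≤ ∑' l, ∫⁻ x in A l, ENNReal.ofReal (x.2 ^ (1 + δ)) ∂N :=
        (lintegral_mono_set hcover).trans (lintegral_iUnion_le _ _)
    _ ≤ ∑' l, ENNReal.ofReal (1 / 2 ^ k * (q ^ (k + l) * ((C + (k + l) : ℕ) : ℝ))) :=
        ENNReal.tsum_le_tsum hband
    _ = ENNReal.ofReal (1 / 2 ^ k) *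
          ∑' l, ENNReal.ofReal (q ^ (k + l) * ((C + (k + l) : ℕ) : ℝ)) := by
        rw [← ENNReal.tsum_mul_left]
        exact tsum_congr fun l => ENNReal.ofReal_mul (by positivity)
    _ ≤ ENNReal.ofReal (1 / 2 ^ k) * ∑' m : ℕ, ENNReal.ofReal (q ^ m * ((C + m : ℕ) : ℝ)) := by
        exact mul_le_mul_right (ENNReal.tsum_comp_le_tsum_of_injective (add_right_injective k)
          (fun m : ℕ => ENNReal.ofReal (q ^ m * ((C + m : ℕ) : ℝ)))) _
    _ = _ := by
        rw [← ENNReal.ofReal_tsum_of_nonneg hnn hsum, ← ENNReal.ofReal_mul (by positivity), mul_comm]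

variable {Ω : Type*} {X : ℕ → Ω → ℝ × ℝ} {ω : Ω}

/-- Every dyadic time interval of length `2⁻ᵏ` contains a point of size at least of order
`2 ^ (-k (1 + δ))`, at all levels `k`. -/
lemma exists_hit (hN : IsDyadicallyRegular (pointMeasure X ω)) {δ : ℝ} (hδ : 0 < δ) :
    ∃ c : ℝ, 0 < c ∧ c ≤ 1 ∧ ∀ k j, j < 2 ^ (k + 1) →
      ∃ n, X n ω ∈ dyadicIoc k j ×ˢ Ioc (c * (1 / 2 ^ k) ^ (1 + δ)) 1 := by
  obtain ⟨K, hK⟩ := eventually_atTop.1 hN.eventually_hit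
  set q : ℝ := (1 / 2 : ℝ) ^ δ with hq
  have hq0 : 0 < q := by positivity
  have hq1 : q < 1 := half_rpow_lt_one hδ
  have hsum := summable_add_mul_geometric 1 hq0.le hq1
  set D : ℝ := ∑' m : ℕ, q ^ m * ((1 + m : ℕ) : ℝ)
  have hD : ∀ m : ℕ, q ^ m * ((m : ℝ) + 1) ≤ D := fun m => by
    have h : q ^ m * ((1 + m : ℕ) : ℝ) ≤ D := hsum.le_tsum m fun i _ => by positivity
    rwa [Nat.cast_add, Nat.cast_one, add_comm] at h
  have hD1 : 1 ≤ D := by simpa using hD 0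
  have hD0 : 0 < D := one_pos.trans_le hD1
  have ha : (0 : ℝ) < 1 / (2 ^ K * ((K : ℝ) + 1)) := by positivity
  refine ⟨min (1 / D) (1 / (2 ^ K * ((K : ℝ) + 1))), by positivity,
    (min_le_left _ _).trans ((div_le_one hD0).2 hD1), fun k j hj => ?_⟩
  set c := min (1 / D) (1 / (2 ^ K * ((K : ℝ) + 1)))
  have hc0 : 0 < c := by positivity
  by_cases hk : K ≤ k
  · obtain ⟨n, hn⟩ := exists_mem_of_pointMeasure_ne_zero
      (measurableSet_dyadicIoc_prod _ _ _ _) (hK k hk j hj)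
    refine ⟨n, hn.1, lt_of_le_of_lt ?_ hn.2.1, hn.2.2⟩
    have h1 : c * (q ^ k * ((k : ℝ) + 1)) ≤ 1 :=
      calc c * (q ^ k * ((k : ℝ) + 1)) ≤ 1 / D * D := by
            gcongr
            · exact min_le_left _ _
            · exact hD k
        _ = 1 := by field_simp
    rw [one_div_two_pow_rpow_one_add, le_div_iff₀ (by positivity), ← hq]
    calc c * (1 / 2 ^ k * q ^ k) * (2 ^ k * ((k : ℝ) + 1)) = c * (q ^ k * ((k : ℝ) + 1)) := by
          field_simp
      _ ≤ 1 := h1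
  · obtain ⟨l, rfl⟩ := Nat.exists_eq_add_of_le (not_le.1 hk).le
    have hj' : j * 2 ^ l < 2 ^ (k + l + 1) :=
      calc j * 2 ^ l < 2 ^ (k + 1) * 2 ^ l := Nat.mul_lt_mul_of_pos_right hj (by positivity)
        _ = 2 ^ (k + l + 1) := by ring
    obtain ⟨n, hn⟩ := exists_mem_of_pointMeasure_ne_zero
      (measurableSet_dyadicIoc_prod _ _ _ _) (hK _ le_rfl _ hj')
    refine ⟨n, dyadicIoc_add_subset k l j hn.1, lt_of_le_of_lt ?_ hn.2.1, hn.2.2⟩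
    have h1 : ((1 : ℝ) / 2 ^ k) ^ (1 + δ) ≤ 1 := by
      refine Real.rpow_le_one (by positivity) ?_ (by linarith)
      rw [div_le_one (by positivity)]
      exact one_le_pow₀ (by norm_num)
    exact (mul_le_of_le_one_right hc0.le h1).trans (min_le_right _ _)

lemma integrableOn_rpow (hN : IsDyadicallyRegular (pointMeasure X ω)) {p : ℝ} (hp : 1 < p) :
    IntegrableOn (fun x : ℝ × ℝ => x.2 ^ p) (Ioc 0 1 ×ˢ Ioc 0 1) (pointMeasure X ω) := by
  obtain ⟨K, -, hK⟩ := hN.exists_lintegral_le (sub_pos.2 hp)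
  have h := hK 0 0 (by norm_num)
  rw [dyadicIoc_zero_zero] at h
  simp only [pow_zero, div_one, add_sub_cancel] at h
  refine ⟨aestronglyMeasurable_pointMeasure _ _, ?_⟩
  rw [hasFiniteIntegral_iff_ofReal]
  · exact h.trans_lt ENNReal.ofReal_lt_top
  · exact ae_restrict_of_forall_mem (measurableSet_Ioc.prod measurableSet_Ioc)
      fun x hx => Real.rpow_nonneg hx.2.1.le _

lemma integrableOn_rpow_one_div (hN : IsDyadicallyRegular (pointMeasure X ω)) {g : ℝ → ℝ} {b : ℝ}
    (hb : b < 1) (hg : ∀ t ∈ Ioc (0 : ℝ) 1, 0 < g t ∧ g t ≤ b) :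
    IntegrableOn (fun x : ℝ × ℝ => x.2 ^ (1 / g x.1)) (Ioc 0 1 ×ˢ Ioc 0 1)
      (pointMeasure X ω) := by
  have hb0 : 0 < b := (hg 1 (by simp)).1.trans_le (hg 1 (by simp)).2
  refine (hN.integrableOn_rpow (one_lt_one_div hb0 hb)).mono'
    (aestronglyMeasurable_pointMeasure _ _) ?_
  refine ae_restrict_of_forall_mem (measurableSet_Ioc.prod measurableSet_Ioc) fun x hx => ?_
  rw [Real.norm_of_nonneg (Real.rpow_nonneg hx.2.1.le _)]
  exact Real.rpow_le_rpow_of_exponent_ge hx.2.1 hx.2.2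
    (one_div_le_one_div_of_le (hg _ hx.1).1 (hg _ hx.1).2)

end IsDyadicallyRegular

/-! ### Increments -/

lemma setIntegral_Ioc_prod_sub {N : Measure (ℝ × ℝ)} {φ : ℝ × ℝ → ℝ}
    (hφ : IntegrableOn φ (Ioc 0 1 ×ˢ Ioc 0 1) N) {s t : ℝ} (hs : 0 ≤ s) (hst : s ≤ t)
    (ht : t ≤ 1) :
    ∫ x in Ioc 0 t ×ˢ Ioc 0 1, φ x ∂N - ∫ x in Ioc 0 s ×ˢ Ioc 0 1, φ x ∂N =
      ∫ x in Ioc s t ×ˢ Ioc 0 1, φ x ∂N := by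
  have hunion : Ioc 0 t ×ˢ Ioc (0 : ℝ) 1 = Ioc 0 s ×ˢ Ioc 0 1 ∪ Ioc s t ×ˢ Ioc 0 1 := by
    rw [← union_prod, Ioc_union_Ioc_eq_Ioc hs hst]
  have hdisj : Disjoint (Ioc 0 s ×ˢ Ioc (0 : ℝ) 1) (Ioc s t ×ˢ Ioc 0 1) :=
    Disjoint.set_prod_left (Ioc_disjoint_Ioc_of_le le_rfl) _ _
  rw [hunion, setIntegral_union hdisj (measurableSet_Ioc.prod measurableSet_Ioc)
    (hφ.mono_set (prod_mono (Ioc_subset_Ioc_right (hst.trans ht)) le_rfl))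
    (hφ.mono_set (prod_mono (Ioc_subset_Ioc hs ht) le_rfl)), add_sub_cancel_left]

lemma stableProcess_sub {N : Measure (ℝ × ℝ)} {α : ℝ}
    (h : IntegrableOn (fun x : ℝ × ℝ => x.2 ^ (1 / α)) (Ioc 0 1 ×ˢ Ioc 0 1) N) {s t : ℝ}
    (hs : 0 ≤ s) (hst : s ≤ t) (ht : t ≤ 1) :
    stableProcess N α t - stableProcess N α s =
      ∫ x in Ioc s t ×ˢ Ioc 0 1, x.2 ^ (1 / α) ∂N :=
  setIntegral_Ioc_prod_sub h hs hst ht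

lemma indexedProcess_sub {N : Measure (ℝ × ℝ)} {f : ℝ → ℝ}
    (h : IntegrableOn (fun x : ℝ × ℝ => x.2 ^ (1 / Function.leftLim f x.1))
      (Ioc 0 1 ×ˢ Ioc 0 1) N) {s t : ℝ} (hs : 0 ≤ s) (hst : s ≤ t) (ht : t ≤ 1) :
    indexedProcess N f t - indexedProcess N f s =
      ∫ x in Ioc s t ×ˢ Ioc 0 1, x.2 ^ (1 / Function.leftLim f x.1) ∂N :=
  setIntegral_Ioc_prod_sub h hs hst ht

lemma setIntegral_rpow_nonneg {N : Measure (ℝ × ℝ)} (g : ℝ → ℝ) (s t : ℝ) :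
    0 ≤ ∫ x in Ioc s t ×ˢ Ioc (0 : ℝ) 1, x.2 ^ (g x.1) ∂N :=
  setIntegral_nonneg (measurableSet_Ioc.prod measurableSet_Ioc)
    fun x hx => Real.rpow_nonneg hx.2.1.le (g x.1)

lemma setIntegral_rpow_mono {N : Measure (ℝ × ℝ)} {g h : ℝ → ℝ} {s t : ℝ}
    (hg : IntegrableOn (fun x : ℝ × ℝ => x.2 ^ (1 / g x.1)) (Ioc s t ×ˢ Ioc 0 1) N)
    (hh : IntegrableOn (fun x : ℝ × ℝ => x.2 ^ (1 / h x.1)) (Ioc s t ×ˢ Ioc 0 1) N)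
    (hgh : ∀ u ∈ Ioc s t, 0 < g u ∧ g u ≤ h u) :
    ∫ x in Ioc s t ×ˢ Ioc 0 1, x.2 ^ (1 / g x.1) ∂N ≤
      ∫ x in Ioc s t ×ˢ Ioc 0 1, x.2 ^ (1 / h x.1) ∂N :=
  setIntegral_mono_on hg hh (measurableSet_Ioc.prod measurableSet_Ioc) fun _ hx =>
    Real.rpow_le_rpow_of_exponent_ge hx.2.1 hx.2.2
      (one_div_le_one_div_of_le (hgh _ hx.1).1 (hgh _ hx.1).2)

section PowerComparison

variable {Ω : Type*} {X : ℕ → Ω → ℝ × ℝ} {ω : Ω}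

/-- The inequality `∑ aᵢ ^ p ≤ (∑ aᵢ) ^ p` with `p = β / α ≥ 1`, applied to the jumps of the
process of index `β`. -/
lemma setIntegral_rpow_le_rpow_setIntegral {α β s t : ℝ} (hα : 0 < α) (hαβ : α < β)
    (hiα : IntegrableOn (fun x : ℝ × ℝ => x.2 ^ (1 / α)) (Ioc s t ×ˢ Ioc 0 1) (pointMeasure X ω))
    (hiβ : IntegrableOn (fun x : ℝ × ℝ => x.2 ^ (1 / β)) (Ioc s t ×ˢ Ioc 0 1)
      (pointMeasure X ω)) :
    ∫ x in Ioc s t ×ˢ Ioc 0 1, x.2 ^ (1 / α) ∂(pointMeasure X ω) ≤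
      (∫ x in Ioc s t ×ˢ Ioc 0 1, x.2 ^ (1 / β) ∂(pointMeasure X ω)) ^ (β / α) := by
  have hβ : 0 < β := hα.trans hαβ
  have hm : MeasurableSet (Ioc s t ×ˢ Ioc (0 : ℝ) 1) := measurableSet_Ioc.prod measurableSet_Ioc
  set R := ∫ x in Ioc s t ×ˢ Ioc 0 1, x.2 ^ (1 / β) ∂(pointMeasure X ω) with hR
  have hR0 : 0 ≤ R := setIntegral_rpow_nonneg (fun _ => 1 / β) s t
  have hp : 0 < β / α - 1 := sub_pos.2 ((one_lt_div hα).2 hαβ)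
  have hpt : ∀ n, X n ω ∈ Ioc s t ×ˢ Ioc (0 : ℝ) 1 →
      (X n ω).2 ^ (1 / α) ≤ R ^ (β / α - 1) * (X n ω).2 ^ (1 / β) := by
    intro n hn
    have hz : 0 < (X n ω).2 := hn.2.1
    have hle : (X n ω).2 ^ (1 / β) ≤ R :=
      le_setIntegral_pointMeasure hm hiβ (fun x hx => Real.rpow_nonneg hx.2.1.le _) hn
    calc (X n ω).2 ^ (1 / α) = ((X n ω).2 ^ (1 / β)) ^ (β / α - 1) * (X n ω).2 ^ (1 / β) := by
          rw [← Real.rpow_mul hz.le, ← Real.rpow_add hz]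
          congr 1
          field_simp
          ring
      _ ≤ R ^ (β / α - 1) * (X n ω).2 ^ (1 / β) := by gcongr
  calc ∫ x in Ioc s t ×ˢ Ioc 0 1, x.2 ^ (1 / α) ∂(pointMeasure X ω)
      ≤ ∫ x in Ioc s t ×ˢ Ioc 0 1, R ^ (β / α - 1) * x.2 ^ (1 / β) ∂(pointMeasure X ω) :=
        integral_mono_ae hiα (hiβ.const_mul _)
          ((ae_restrict_iff' hm).2 (ae_pointMeasure_of_forall hpt))
    _ = R ^ (β / α - 1) * R := integral_const_mul _ _
    _ = R ^ (β / α) := by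
        rcases hR0.eq_or_lt with h | h
        · rw [← h, Real.zero_rpow hp.ne', Real.zero_rpow (by linarith), zero_mul]
        · rw [Real.rpow_sub_one h.ne', div_mul_cancel₀ _ h.ne']

/-- A time interval `(s, t]` on which all points have size at most `ρ` contains no dyadic interval
of a level at which every interval is hit by a point of size larger than `ρ`; it is then covered by
two neighbouring intervals of this level. -/
lemma exists_subset_dyadicIoc_union {s t ρ : ℝ} {k : ℕ} (hs : 0 ≤ s) (hst : s < t) (ht : t ≤ 1)
    (hρ : ∀ n, X n ω ∈ Ioc s t ×ˢ Ioc (0 : ℝ) 1 → (X n ω).2 ≤ ρ) (hρ0 : 0 ≤ ρ)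
    (hhit : ∀ j < 2 ^ (k + 1), ∃ n, X n ω ∈ dyadicIoc k j ×ˢ Ioc ρ 1) :
    ∃ j, j + 1 < 2 ^ (k + 1) ∧ Ioc s t ⊆ dyadicIoc k j ∪ dyadicIoc k (j + 1) := by
  have hpos : (0 : ℝ) < 2 ^ k := by positivity
  have hs0 : 0 ≤ s * 2 ^ k := by positivity
  set j := ⌊s * 2 ^ k⌋₊ with hj
  have h1 : (j : ℝ) ≤ s * 2 ^ k := Nat.floor_le hs0
  have h2 : s * 2 ^ k < j + 1 := Nat.lt_floor_add_one _
  have hj1 : j + 1 < 2 ^ (k + 1) := by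
    have h3 : j < 2 ^ k := by
      have : (j : ℝ) < 2 ^ k := h1.trans_lt (mul_lt_of_lt_one_left hpos (hst.trans_le ht))
      exact_mod_cast this
    have : 1 ≤ 2 ^ k := Nat.one_le_two_pow
    rw [pow_succ]
    omega
  have hte : t * 2 ^ k ≤ j + 1 + 1 := by
    by_contra! hlt
    obtain ⟨n, hn⟩ := hhit _ hj1
    have hd := mem_dyadicIoc.1 hn.1
    push_cast at hd
    refine (hρ n ⟨⟨?_, ?_⟩, hρ0.trans_lt hn.2.1, hn.2.2⟩).not_gt hn.2.1
    · exact lt_of_mul_lt_mul_right (h2.trans hd.1) hpos.le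
    · exact le_of_mul_le_mul_right (hd.2.trans hlt.le) hpos
  refine ⟨j, hj1, fun u hu => ?_⟩
  have hu1 : s * 2 ^ k < u * 2 ^ k := mul_lt_mul_of_pos_right hu.1 hpos
  have hu2 : u * 2 ^ k ≤ t * 2 ^ k := mul_le_mul_of_nonneg_right hu.2 hpos.le
  rcases le_or_gt (u * 2 ^ k) (j + 1) with h | h
  · exact Or.inl (mem_dyadicIoc.2 ⟨h1.trans_lt hu1, h⟩)
  · refine Or.inr (mem_dyadicIoc.2 ⟨?_, ?_⟩) <;> push_cast
    · exact h
    · exact hu2.trans hte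

lemma exists_two_pow_scale {c ρ δ : ℝ} (hδ : 0 < δ) (hρ0 : 0 < ρ) (hρ : ρ < c) :
    ∃ k : ℕ, ρ < c * (1 / 2 ^ k) ^ (1 + δ) ∧ c * (1 / 2 ^ (k + 1)) ^ (1 + δ) ≤ ρ := by
  have hc : 0 < c := hρ0.trans hρ
  have hex : ∃ k : ℕ, c * (1 / 2 ^ k) ^ (1 + δ) ≤ ρ := by
    obtain ⟨k, hk⟩ := exists_pow_lt_of_lt_one (div_pos hρ0 hc) (by norm_num : (1 / 2 : ℝ) < 1)
    refine ⟨k, ?_⟩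
    rw [← le_div_iff₀' hc]
    rw [one_div_pow] at hk
    refine le_trans ?_ hk.le
    refine Real.rpow_le_self_of_le_one (by positivity) ?_ (by linarith)
    rw [div_le_one (by positivity)]
    exact one_le_pow₀ (by norm_num)
  classical
  obtain ⟨k, hk⟩ : ∃ k, Nat.find hex = k + 1 := by
    refine Nat.exists_eq_succ_of_ne_zero fun h => ?_
    have := Nat.find_spec hex
    rw [h] at this
    norm_num at this
    exact this.not_gt hρ
  refine ⟨k, ?_, ?_⟩
  · have := Nat.find_min hex (m := k) (by omega)
    exact not_le.1 this
  · have := Nat.find_spec hex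
    rwa [hk] at this

/-- If the points of a regular configuration in the time interval `(s, t]` have size at most `ρ`,
the increment over `(s, t]` of the process of index `β` is of order `ρ ^ θ` for every `θ < 1 / β`.
The absence of points larger than `ρ` forces `t - s` to be at most of order `ρ ^ (1 / (1 + δ))`, and
the small points in an interval of this length have a controlled `(1 + δ)`-th moment. -/
lemma IsDyadicallyRegular.exists_setIntegral_le
    (hN : IsDyadicallyRegular (pointMeasure X ω)) {β θ : ℝ} (hβ : 0 < β) (hβ1 : β < 1)
    (hθ0 : 0 < θ) (hθ : θ < 1 / β) :
    ∃ C : ℝ, 0 ≤ C ∧ ∀ s t ρ : ℝ, 0 ≤ s → s < t → t ≤ 1 → 0 < ρ →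
      (∀ n, X n ω ∈ Ioc s t ×ˢ Ioc (0 : ℝ) 1 → (X n ω).2 ≤ ρ) →
      ∫ x in Ioc s t ×ˢ Ioc 0 1, x.2 ^ (1 / β) ∂(pointMeasure X ω) ≤ C * ρ ^ θ := by
  have hβ' : 1 < 1 / β := one_lt_one_div hβ hβ1
  -- `δ` is so small that `1 / β - (1 + δ) + 1 / (1 + δ)` is at least `θ`
  obtain ⟨δ, hδ, hδ1, hδ2⟩ : ∃ δ : ℝ, 0 < δ ∧ 1 + δ ≤ 1 / β ∧ θ ≤ 1 / β - 2 * δ := by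
    refine ⟨min ((1 / β - θ) / 2) (1 / β - 1), lt_min (by linarith) (by linarith), ?_, ?_⟩
    · linarith [min_le_right ((1 / β - θ) / 2) (1 / β - 1)]
    · linarith [min_le_left ((1 / β - θ) / 2) (1 / β - 1)]
  obtain ⟨c, hc0, hc1, hc⟩ := hN.exists_hit hδ
  obtain ⟨K, hK0, hK⟩ := hN.exists_lintegral_le hδ
  have hiβ := hN.integrableOn_rpow hβ'
  set B := ∫ x in Ioc 0 1 ×ˢ Ioc 0 1, x.2 ^ (1 / β) ∂(pointMeasure X ω) with hB
  have hB0 : 0 ≤ B := setIntegral_rpow_nonneg (fun _ => 1 / β) 0 1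
  have hm : ∀ a b : ℝ, MeasurableSet (Ioc a b ×ˢ Ioc (0 : ℝ) 1) :=
    fun a b => measurableSet_Ioc.prod measurableSet_Ioc
  refine ⟨B * (1 / c) ^ θ + 4 * K * (1 / c) ^ (1 / (1 + δ)), by positivity, ?_⟩
  intro s t ρ hs hst ht hρ0 hρ
  have hsub : Ioc s t ×ˢ Ioc (0 : ℝ) 1 ⊆ Ioc 0 1 ×ˢ Ioc 0 1 :=
    prod_mono (Ioc_subset_Ioc hs ht) le_rfl
  rcases le_or_gt c ρ with hcρ | hcρ
  · calc ∫ x in Ioc s t ×ˢ Ioc 0 1, x.2 ^ (1 / β) ∂(pointMeasure X ω)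
        ≤ B := setIntegral_mono_set hiβ (ae_restrict_of_forall_mem (hm 0 1)
          fun x hx => Real.rpow_nonneg hx.2.1.le _) hsub.eventuallyLE
      _ ≤ B * ((1 / c) ^ θ * ρ ^ θ) := by
          refine le_mul_of_one_le_right hB0 ?_
          rw [← Real.mul_rpow (by positivity) hρ0.le, one_div_mul_eq_div]
          exact Real.one_le_rpow ((one_le_div hc0).2 hcρ) hθ0.le
      _ ≤ _ := by
          rw [add_mul, ← mul_assoc]
          exact le_add_of_nonneg_right (by positivity)
  · obtain ⟨k, hk1, hk2⟩ := exists_two_pow_scale hδ hρ0 hcρ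
    have hhit : ∀ j < 2 ^ (k + 1), ∃ n, X n ω ∈ dyadicIoc k j ×ˢ Ioc ρ 1 := fun j hj => by
      obtain ⟨n, hn⟩ := hc k j hj
      exact ⟨n, hn.1, hk1.trans hn.2.1, hn.2.2⟩
    obtain ⟨j, hj, hcov⟩ := exists_subset_dyadicIoc_union hs hst ht hρ hρ0.le hhit
    have hu1 : (1 : ℝ) / 2 ^ k ≤ 1 := by
      rw [div_le_one (by positivity)]
      exact one_le_pow₀ (by norm_num)
    have hρk : ρ ≤ 1 / 2 ^ k := by
      refine hk1.le.trans ((mul_le_of_le_one_left (by positivity) hc1).trans ?_)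
      exact Real.rpow_le_self_of_le_one (by positivity) hu1 (by linarith)
    have hlen : (1 : ℝ) / 2 ^ k ≤ 2 * ((1 / c) ^ (1 / (1 + δ)) * ρ ^ (1 / (1 + δ))) := by
      rw [← Real.mul_rpow (by positivity) hρ0.le, one_div_mul_eq_div]
      have h1 : ((1 : ℝ) / 2 ^ (k + 1)) ^ (1 + δ) ≤ ρ / c := (le_div_iff₀' hc0).2 hk2
      have h2 := Real.rpow_le_rpow (by positivity) h1 (by positivity : 0 ≤ 1 / (1 + δ))
      rw [← Real.rpow_mul (by positivity), mul_one_div_cancel (by positivity), Real.rpow_one] at h2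
      calc (1 : ℝ) / 2 ^ k = 2 * (1 / 2 ^ (k + 1)) := by rw [pow_succ]; field_simp
        _ ≤ _ := by gcongr
    let D : ℕ → Set (ℝ × ℝ) := fun i => dyadicIoc k i ×ˢ Ioc 0 (1 / 2 ^ k)
    have hJD : (Ioc s t ×ˢ Ioc (0 : ℝ) 1 : Set (ℝ × ℝ)) ≤ᵐ[pointMeasure X ω]
        (D j ∪ D (j + 1) : Set (ℝ × ℝ)) := by
      refine ae_pointMeasure_of_forall (p := fun x => x ∈ Ioc s t ×ˢ Ioc (0 : ℝ) 1 →
        x ∈ D j ∪ D (j + 1)) fun n hn => ?_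
      rw [← union_prod]
      exact ⟨hcov hn.1, hn.2.1, (hρ n hn).trans hρk⟩
    have hmom : ∫⁻ x in Ioc s t ×ˢ Ioc 0 1, ENNReal.ofReal (x.2 ^ (1 + δ)) ∂(pointMeasure X ω) ≤
        ENNReal.ofReal (2 * K * (1 / 2 ^ k)) :=
      calc _ ≤ ∫⁻ x in D j ∪ D (j + 1), ENNReal.ofReal (x.2 ^ (1 + δ)) ∂(pointMeasure X ω) :=
            lintegral_mono_set' hJD
        _ ≤ _ := lintegral_union_le _ _ _
        _ ≤ ENNReal.ofReal (K * (1 / 2 ^ k)) + ENNReal.ofReal (K * (1 / 2 ^ k)) :=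
            add_le_add (hK k j (by omega)) (hK k (j + 1) hj)
        _ = _ := by
            rw [← ENNReal.ofReal_add (by positivity) (by positivity)]
            ring_nf
    have hi1 := (hN.integrableOn_rpow (by linarith : 1 < 1 + δ)).mono_set hsub
    have hmom' : ∫ x in Ioc s t ×ˢ Ioc 0 1, x.2 ^ (1 + δ) ∂(pointMeasure X ω) ≤
        2 * K * (1 / 2 ^ k) := by
      rw [← ENNReal.ofReal_le_ofReal_iff (by positivity),
        ofReal_integral_eq_lintegral_ofReal hi1 (ae_restrict_of_forall_mem (hm s t)
          fun x hx => Real.rpow_nonneg hx.2.1.le _)]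
      exact hmom
    have hexp : θ ≤ 1 / β - (1 + δ) + 1 / (1 + δ) := by
      have : 1 - δ ≤ 1 / (1 + δ) := by
        rw [le_div_iff₀ (by positivity)]
        nlinarith [sq_nonneg δ]
      linarith
    calc ∫ x in Ioc s t ×ˢ Ioc 0 1, x.2 ^ (1 / β) ∂(pointMeasure X ω)
        ≤ ∫ x in Ioc s t ×ˢ Ioc 0 1, ρ ^ (1 / β - (1 + δ)) * x.2 ^ (1 + δ)
            ∂(pointMeasure X ω) := by
          refine integral_mono_ae (hiβ.mono_set hsub) (hi1.const_mul _)
            ((ae_restrict_iff' (hm s t)).2 (ae_pointMeasure_of_forall fun n hn => ?_))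
          have hz : 0 < (X n ω).2 := hn.2.1
          calc (X n ω).2 ^ (1 / β)
              = (X n ω).2 ^ (1 / β - (1 + δ)) * (X n ω).2 ^ (1 + δ) := by
                rw [← Real.rpow_add hz, sub_add_cancel]
            _ ≤ ρ ^ (1 / β - (1 + δ)) * (X n ω).2 ^ (1 + δ) := by
                exact mul_le_mul_of_nonneg_right
                  (Real.rpow_le_rpow hz.le (hρ n hn) (by linarith)) (Real.rpow_nonneg hz.le _)
      _ = ρ ^ (1 / β - (1 + δ)) * ∫ x in Ioc s t ×ˢ Ioc 0 1, x.2 ^ (1 + δ)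
            ∂(pointMeasure X ω) := integral_const_mul _ _
      _ ≤ ρ ^ (1 / β - (1 + δ)) *
            (2 * K * (2 * ((1 / c) ^ (1 / (1 + δ)) * ρ ^ (1 / (1 + δ))))) := by
          gcongr
          exact hmom'.trans (by gcongr)
      _ = 4 * K * (1 / c) ^ (1 / (1 + δ)) * ρ ^ (1 / β - (1 + δ) + 1 / (1 + δ)) := by
          rw [Real.rpow_add hρ0]
          ring
      _ ≤ 4 * K * (1 / c) ^ (1 / (1 + δ)) * ρ ^ θ := by
          exact mul_le_mul_of_nonneg_left
            (Real.rpow_le_rpow_of_exponent_ge hρ0 (hcρ.le.trans hc1) hexp) (by positivity)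
      _ ≤ _ := by
          rw [add_mul]
          exact le_add_of_nonneg_left (by positivity)

/-- The converse, up to an arbitrarily small loss in the exponent, of
`setIntegral_rpow_le_rpow_setIntegral`. -/
lemma IsDyadicallyRegular.exists_setIntegral_le_rpow_setIntegral
    (hN : IsDyadicallyRegular (pointMeasure X ω)) {α β η : ℝ} (hα : 0 < α) (hα1 : α < 1)
    (hβ : 0 < β) (hβ1 : β < 1) (hη0 : 0 < η) (hη : η < α / β) :
    ∃ C : ℝ, 0 ≤ C ∧ ∀ s t : ℝ, 0 ≤ s → s < t → t ≤ 1 →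
      ∫ x in Ioc s t ×ˢ Ioc 0 1, x.2 ^ (1 / β) ∂(pointMeasure X ω) ≤
        C * (∫ x in Ioc s t ×ˢ Ioc 0 1, x.2 ^ (1 / α) ∂(pointMeasure X ω)) ^ η := by
  obtain ⟨C, hC0, hC⟩ := hN.exists_setIntegral_le (θ := η / α) hβ hβ1 (by positivity)
    (by rwa [div_lt_div_iff₀ hα hβ, one_mul, ← lt_div_iff₀ hβ])
  refine ⟨C, hC0, fun s t hs hst ht => ?_⟩
  have hm : MeasurableSet (Ioc s t ×ˢ Ioc (0 : ℝ) 1) := measurableSet_Ioc.prod measurableSet_Ioc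
  have hi := (hN.integrableOn_rpow (one_lt_one_div hα hα1)).mono_set
    (prod_mono (Ioc_subset_Ioc hs ht) le_rfl)
  set r := ∫ x in Ioc s t ×ˢ Ioc 0 1, x.2 ^ (1 / α) ∂(pointMeasure X ω) with hr
  have hr0 : 0 ≤ r := setIntegral_rpow_nonneg (fun _ => 1 / α) s t
  have hle : ∀ n, X n ω ∈ Ioc s t ×ˢ Ioc (0 : ℝ) 1 → (X n ω).2 ^ (1 / α) ≤ r := fun n hn =>
    le_setIntegral_pointMeasure hm hi (fun x hx => Real.rpow_nonneg hx.2.1.le _) hn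
  -- a vanishing increment means that there are no points at all in `(s, t]`
  rcases hr0.eq_or_lt with h0 | h0
  · have hz : ∀ᵐ x ∂(pointMeasure X ω), x ∈ Ioc s t ×ˢ Ioc (0 : ℝ) 1 → x.2 ^ (1 / β) = 0 :=
      ae_pointMeasure_of_forall fun n hn =>
        absurd (hle n hn) (not_le.2 (h0 ▸ Real.rpow_pos_of_pos hn.2.1 _))
    rw [setIntegral_congr_ae hm hz, integral_zero]
    positivity
  · have hpt : ∀ n, X n ω ∈ Ioc s t ×ˢ Ioc (0 : ℝ) 1 → (X n ω).2 ≤ r ^ α := fun n hn => by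
      have h1 := Real.rpow_le_rpow (Real.rpow_nonneg hn.2.1.le _) (hle n hn) hα.le
      rwa [← Real.rpow_mul hn.2.1.le, one_div_mul_cancel hα.ne', Real.rpow_one] at h1
    have h2 := hC s t (r ^ α) hs hst ht (by positivity) hpt
    rwa [← Real.rpow_mul h0.le, mul_div_cancel₀ _ hα.ne'] at h2

end PowerComparison

/-! ### Comparison of Hausdorff dimensions -/

/-- If the increments of `h` on `E` are bounded by a power `η` of those of `g`, then `h` factors on
`E` through `g` and an `η`-Hölder map. -/
lemma dimH_image_le_of_increments {g h : ℝ → ℝ} {E : Set ℝ} {C η : ℝ} (hC : 0 ≤ C) (hη : 0 < η)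
    (H : ∀ s ∈ E, ∀ t ∈ E, s < t → |h t - h s| ≤ C * |g t - g s| ^ η) :
    dimH (h '' E) ≤ dimH (g '' E) / ENNReal.ofReal η := by
  have H' : ∀ s ∈ E, ∀ t ∈ E, |h s - h t| ≤ C * |g s - g t| ^ η := by
    intro s hs t ht
    rcases lt_trichotomy s t with hst | rfl | hst
    · rw [abs_sub_comm, abs_sub_comm (g s)]; exact H s hs t ht hst
    · simp [Real.zero_rpow hη.ne']
    · exact H t ht s hs hst
  let Φ : ℝ → ℝ := fun y => h (Function.invFunOn g E y)
  have hinv : ∀ t ∈ E, Function.invFunOn g E (g t) ∈ E ∧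
      g (Function.invFunOn g E (g t)) = g t := fun t ht =>
    ⟨Function.invFunOn_mem ⟨t, ht, rfl⟩, Function.invFunOn_eq ⟨t, ht, rfl⟩⟩
  have hΦ : Φ '' (g '' E) = h '' E := by
    rw [image_image]
    refine image_congr fun t ht => ?_
    have := H' _ (hinv t ht).1 t ht
    rw [(hinv t ht).2, sub_self, abs_zero, Real.zero_rpow hη.ne', mul_zero] at this
    exact sub_eq_zero.1 (abs_nonpos_iff.1 this)
  have hold : HolderOnWith C.toNNReal η.toNNReal Φ (g '' E) := by
    rintro _ ⟨s, hs, rfl⟩ _ ⟨t, ht, rfl⟩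
    have := H' _ (hinv s hs).1 _ (hinv t ht).1
    rw [(hinv s hs).2, (hinv t ht).2] at this
    rw [edist_dist, edist_dist, Real.dist_eq, Real.dist_eq, Real.coe_toNNReal _ hη.le,
      ENNReal.ofReal_rpow_of_nonneg (abs_nonneg _) hη.le, ← ENNReal.ofReal_coe_nnreal,
      Real.coe_toNNReal _ hC, ← ENNReal.ofReal_mul hC]
    exact ENNReal.ofReal_le_ofReal this
  rw [← hΦ]
  exact hold.dimH_image_le (Real.toNNReal_pos.2 hη)

lemma dimH_image_le_of_increments_le {g h : ℝ → ℝ} {E : Set ℝ}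
    (H : ∀ s ∈ E, ∀ t ∈ E, s < t → |h t - h s| ≤ |g t - g s|) :
    dimH (h '' E) ≤ dimH (g '' E) := by
  simpa using dimH_image_le_of_increments (g := g) (h := h) (E := E) zero_le_one one_pos
    (by simpa using H)

/-- The uniform dimension formula: on a regular configuration, the dimensions of the images of `E`
under two stable processes are proportional to the indices. -/
lemma IsDyadicallyRegular.dimH_stableProcess_image {Ω : Type*} {X : ℕ → Ω → ℝ × ℝ} {ω : Ω}
    (hN : IsDyadicallyRegular (pointMeasure X ω)) {α β : ℝ} (hα : 0 < α) (hαβ : α < β)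
    (hβ1 : β < 1) {E : Set ℝ} (hE : E ⊆ Icc 0 1) :
    dimH (stableProcess (pointMeasure X ω) β '' E) =
      ENNReal.ofReal (β / α) * dimH (stableProcess (pointMeasure X ω) α '' E) := by
  have hβ : 0 < β := hα.trans hαβ
  have hiα := hN.integrableOn_rpow (one_lt_one_div hα (hαβ.trans hβ1))
  have hiβ := hN.integrableOn_rpow (one_lt_one_div hβ hβ1)
  have hpos : 0 < β / α := by positivity
  -- for the upper bound, the Hölder exponent `η = 1 / q` increases to `α / β`
  refine le_antisymm ?_ ?_
  · have hq : ∀ q : ℝ, β / α < q → dimH (stableProcess (pointMeasure X ω) β '' E) ≤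
        ENNReal.ofReal q * dimH (stableProcess (pointMeasure X ω) α '' E) := by
      intro q hq
      have hq0 : 0 < q := hpos.trans hq
      have hη : 1 / q < α / β := by
        rw [← one_div_div β α]
        exact one_div_lt_one_div_of_lt hpos hq
      obtain ⟨C, hC0, hC⟩ := hN.exists_setIntegral_le_rpow_setIntegral hα (hαβ.trans hβ1) hβ hβ1
        (by positivity) hη
      have := dimH_image_le_of_increments (g := stableProcess (pointMeasure X ω) α)
        (h := stableProcess (pointMeasure X ω) β) (E := E) (η := 1 / q) hC0 (by positivity) ?_
      · rwa [ENNReal.ofReal_div_of_pos hq0, ENNReal.ofReal_one, div_eq_mul_inv, one_div, inv_inv,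
          mul_comm] at this
      · intro s hs t ht hst
        rw [stableProcess_sub hiα (hE hs).1 hst.le (hE ht).2,
          stableProcess_sub hiβ (hE hs).1 hst.le (hE ht).2,
          abs_of_nonneg (setIntegral_rpow_nonneg (fun _ => 1 / α) s t),
          abs_of_nonneg (setIntegral_rpow_nonneg (fun _ => 1 / β) s t)]
        exact hC s t (hE hs).1 hst (hE ht).2
    have hlim : Tendsto (fun q : ℝ => ENNReal.ofReal q *
        dimH (stableProcess (pointMeasure X ω) α '' E)) (𝓝[>] (β / α))
        (𝓝 (ENNReal.ofReal (β / α) * dimH (stableProcess (pointMeasure X ω) α '' E))) :=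
      ENNReal.Tendsto.mul_const
        ((ENNReal.continuous_ofReal.tendsto _).mono_left nhdsWithin_le_nhds)
        (Or.inl (ENNReal.ofReal_pos.2 hpos).ne')
    exact ge_of_tendsto hlim (eventually_nhdsWithin_of_forall hq)
  · have h : dimH (stableProcess (pointMeasure X ω) α '' E) ≤
        dimH (stableProcess (pointMeasure X ω) β '' E) / ENNReal.ofReal (β / α) := by
      refine dimH_image_le_of_increments zero_le_one hpos fun s hs t ht hst => ?_
      have hsub : Ioc s t ×ˢ Ioc (0 : ℝ) 1 ⊆ Ioc 0 1 ×ˢ Ioc 0 1 :=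
        prod_mono (Ioc_subset_Ioc (hE hs).1 (hE ht).2) le_rfl
      rw [stableProcess_sub hiα (hE hs).1 hst.le (hE ht).2,
        stableProcess_sub hiβ (hE hs).1 hst.le (hE ht).2,
        abs_of_nonneg (setIntegral_rpow_nonneg (fun _ => 1 / α) s t),
        abs_of_nonneg (setIntegral_rpow_nonneg (fun _ => 1 / β) s t), one_mul]
      exact setIntegral_rpow_le_rpow_setIntegral hα hαβ (hiα.mono_set hsub) (hiβ.mono_set hsub)
    rw [mul_comm]
    exact (ENNReal.le_div_iff_mul_le (Or.inl (ENNReal.ofReal_pos.2 hpos).ne')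
      (Or.inl ENNReal.ofReal_ne_top)).1 h

lemma hausdorffDim_image_of_nonempty (g : ℝ → ℝ) {E : Set ℝ} (hE : E.Nonempty) :
    hausdorffDim (g '' E) = ((dimH (g '' E) : ℝ≥0∞) : EReal) :=
  if_neg (hE.image g).ne_empty

lemma hausdorffDim_empty : hausdorffDim ∅ = ⊥ := if_pos rfl

lemma IsIndexFunction.leftLim_mem_Icc {ε : ℝ} {f : ℝ → ℝ} (hf : IsIndexFunction ε f) {s t u : ℝ}
    (hs : 0 ≤ s) (hsu : s < u) (hut : u ≤ t) (ht : t ≤ 1) :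
    Function.leftLim f u ∈ Icc (f s) (f t) := by
  obtain ⟨l, hl⟩ := hf.cadlag.2 u ⟨hs.trans_lt hsu, hut.trans ht⟩
  rw [leftLim_eq_of_tendsto hl]
  have hmem : ∀ᶠ v in 𝓝[<] u, v ∈ Ioo s u := Ioo_mem_nhdsLT hsu
  have hI : ∀ v ∈ Ioo s u, v ∈ Icc (0 : ℝ) 1 := fun v hv =>
    ⟨hs.trans hv.1.le, hv.2.le.trans (hut.trans ht)⟩
  refine ⟨ge_of_tendsto hl ?_, le_of_tendsto hl ?_⟩
  · filter_upwards [hmem] with v hv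
    exact hf.monotoneOn ⟨hs, hsu.le.trans (hut.trans ht)⟩ (hI v hv) hv.1.le
  · filter_upwards [hmem] with v hv
    exact hf.monotoneOn (hI v hv) ⟨hs.trans (hsu.le.trans hut), ht⟩ (hv.2.le.trans hut)

theorem mainTheorem6 {Ω : Type*} [MeasurableSpace Ω] (P : Measure Ω) [IsProbabilityMeasure P]
    (T Z : ℕ → Ω → ℝ)
    (hPoisson : IsPoissonPointProcess (fun n ω => (T n ω, Z n ω)) stableIntensity P)
    (ε : ℝ) (hε : 0 < ε) :
    ∀ᵐ ω ∂P, ∀ N : Measure (ℝ × ℝ), N = pointMeasure (fun n ω => (T n ω, Z n ω)) ω →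
      (∀ α ∈ Ioo ε (1 - ε),
        IntegrableOn (fun x : ℝ × ℝ => x.2 ^ (1 / α)) (Ioc 0 1 ×ˢ Ioc 0 1) N) ∧
      (∀ f : ℝ → ℝ, IsIndexFunction ε f →
        IntegrableOn (fun x : ℝ × ℝ => x.2 ^ (1 / Function.leftLim f x.1))
          (Ioc 0 1 ×ˢ Ioc 0 1) N) ∧
      ∀ E : Set ℝ, E ⊆ Icc 0 1 → ∀ f : ℝ → ℝ, IsIndexFunction ε f →
        ∀ α ∈ Ioo ε (1 - ε), ∀ β ∈ Ioo ε (1 - ε),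
          (α : EReal) < ⨅ t ∈ E, (f t : EReal) → ⨆ t ∈ E, (f t : EReal) < (β : EReal) →
            hausdorffDim (stableProcess N α '' E) ≤ hausdorffDim (indexedProcess N f '' E) ∧
            hausdorffDim (indexedProcess N f '' E) ≤ hausdorffDim (stableProcess N β '' E) ∧
            hausdorffDim (stableProcess N β '' E) =
              ((β / α : ℝ) : EReal) * hausdorffDim (stableProcess N α '' E) := by
  filter_upwards [ae_isDyadicallyRegular hPoisson] with ω hreg
  rintro N rfl
  have hint : ∀ α ∈ Ioo ε (1 - ε), IntegrableOn (fun x : ℝ × ℝ => x.2 ^ (1 / α))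
      (Ioc 0 1 ×ˢ Ioc 0 1) (pointMeasure (fun n ω => (T n ω, Z n ω)) ω) := fun α hα =>
    hreg.integrableOn_rpow (one_lt_one_div (hε.trans hα.1) (by linarith [hα.2]))
  have hintf : ∀ f : ℝ → ℝ, IsIndexFunction ε f →
      IntegrableOn (fun x : ℝ × ℝ => x.2 ^ (1 / Function.leftLim f x.1))
        (Ioc 0 1 ×ˢ Ioc 0 1) (pointMeasure (fun n ω => (T n ω, Z n ω)) ω) := by
    intro f hf
    refine hreg.integrableOn_rpow_one_div (b := 1 - ε) (by linarith) fun t ht => ?_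
    have h := hf.leftLim_mem_Icc le_rfl ht.1 ht.2 le_rfl
    exact ⟨hε.trans_le ((hf.mapsTo (by simp)).1.trans h.1), h.2.trans (hf.mapsTo (by simp)).2⟩
  refine ⟨hint, hintf, fun E hE f hf α hα β hβ hαf hfβ => ?_⟩
  have hα0 : 0 < α := hε.trans hα.1
  have hβ0 : 0 < β := hε.trans hβ.1
  rcases E.eq_empty_or_nonempty with rfl | hne
  · simp only [image_empty, hausdorffDim_empty, le_refl, true_and]
    rw [EReal.coe_mul_bot_of_pos (by positivity)]
  have hαf' : ∀ t ∈ E, α < f t := fun t ht =>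
    EReal.coe_lt_coe_iff.1 (hαf.trans_le (iInf₂_le t ht))
  have hfβ' : ∀ t ∈ E, f t < β := fun t ht =>
    EReal.coe_lt_coe_iff.1 ((le_iSup₂ (f := fun t (_ : t ∈ E) => (f t : EReal)) t ht).trans_lt hfβ)
  have hαβ : α < β := (hαf' _ hne.some_mem).trans (hfβ' _ hne.some_mem)
  -- between two points of `E` the index lies in `[α, β]`, so that the increments are ordered
  have hidx : ∀ s ∈ E, ∀ t ∈ E, ∀ u ∈ Ioc s t,
      α ≤ Function.leftLim f u ∧ Function.leftLim f u ≤ β := by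
    intro s hs t ht u hu
    have h := hf.leftLim_mem_Icc (hE hs).1 hu.1 hu.2 (hE ht).2
    exact ⟨(hαf' s hs).le.trans h.1, h.2.trans (hfβ' t ht).le⟩
  have hsub : ∀ s ∈ E, ∀ t ∈ E, Ioc s t ×ˢ Ioc (0 : ℝ) 1 ⊆ Ioc 0 1 ×ˢ Ioc 0 1 :=
    fun s hs t ht => prod_mono (Ioc_subset_Ioc (hE hs).1 (hE ht).2) le_rfl
  simp only [hausdorffDim_image_of_nonempty _ hne, EReal.coe_ennreal_le_coe_ennreal_iff]
  refine ⟨?_, ?_, ?_⟩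
  · refine dimH_image_le_of_increments_le fun s hs t ht hst => ?_
    rw [stableProcess_sub (hint α hα) (hE hs).1 hst.le (hE ht).2,
      indexedProcess_sub (hintf f hf) (hE hs).1 hst.le (hE ht).2,
      abs_of_nonneg (setIntegral_rpow_nonneg (fun _ => 1 / α) s t),
      abs_of_nonneg (setIntegral_rpow_nonneg (fun u => 1 / Function.leftLim f u) s t)]
    exact setIntegral_rpow_mono (g := fun _ => α) ((hint α hα).mono_set (hsub s hs t ht))
      ((hintf f hf).mono_set (hsub s hs t ht)) fun u hu => ⟨hα0, (hidx s hs t ht u hu).1⟩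
  · refine dimH_image_le_of_increments_le fun s hs t ht hst => ?_
    rw [stableProcess_sub (hint β hβ) (hE hs).1 hst.le (hE ht).2,
      indexedProcess_sub (hintf f hf) (hE hs).1 hst.le (hE ht).2,
      abs_of_nonneg (setIntegral_rpow_nonneg (fun _ => 1 / β) s t),
      abs_of_nonneg (setIntegral_rpow_nonneg (fun u => 1 / Function.leftLim f u) s t)]
    exact setIntegral_rpow_mono (h := fun _ => β) ((hintf f hf).mono_set (hsub s hs t ht))
      ((hint β hβ).mono_set (hsub s hs t ht)) fun u hu =>
        ⟨hα0.trans_le (hidx s hs t ht u hu).1, (hidx s hs t ht u hu).2⟩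
  · rw [hreg.dimH_stableProcess_image hα0 hαβ (by linarith [hβ.2]) hE, EReal.coe_ennreal_mul,
      EReal.coe_ennreal_ofReal, max_eq_left (by positivity)]
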